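/- **The Schori solenoid.** Let $X_0$ be a closed orientable surface of genus $2$, the union of two one-holed tori $H_0, F_0$ meeting along their common boundary circle, and let $C_0\subset H_0$, $D_0\subset F_0$ be disjoint simple closed non-separating curves in the interiors of the handles. Concretely, let $Y=\{(x,y,z)\in S^2 : |x|+|z|\le 5/4\}$, a sphere with four open discs removed, whose boundary circles are $C'$ ($x>0,z>0$), $C''$ ($x<0,z>0$), $D'$ ($x>0,z<0$), $D''$ ($x<0,z<0$). Then $X_0$ is $Y$ with $C'$ glued to $C''$ (giving $C_0$) and $D'$ glued to $D''$ (giving $D_0$) by $x\mapsto -x$; $H_0$ is the image of $\{z\ge 0\}$ and $F_0$ that of $\{z\le 0\}$. Let $x_0\in H_0\cap F_0$ be the image of $(0,1,0)$. Given $X_k$ with $C_k, D_k$ and a base point $x_k$, let $X_{k+1}$ be made from three copies of $X_k$ cut open along $C_k$ and $D_k$, where $C_k$ has sides $C_k',C_k''$ and $D_k$ has sides $D_k',D_k''$, by gluing (superscripts number the copies) $$C_k^{1\prime}\sim C_k^{1\prime\prime},\quad C_k^{2\prime}\sim C_k^{3\prime\prime},\quad C_k^{3\prime}\sim C_k^{2\prime\prime},\qquad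 D_k^{1\prime}\sim D_k^{2\prime\prime},\quad D_k^{2\prime}\sim D_k^{1\prime\prime},\quad D_k^{3\prime}\sim D_k^{3\prime\prime}.$$ Let $x_{k+1}$ be the copy of $x_k$ in copy number $2$, let $C_{k+1}$ be the seam $C_k^{3\prime}\sim C_k^{2\prime\prime}$ and $D_{k+1}$ the seam $D_k^{1\prime}\sim D_k^{2\prime\prime}$. Forgetting the number of the copy is a $3$-to-$1$ covering $f^{k+1}_k:X_{k+1}\to X_k$, and the Schori solenoid is $X_{\rm Sch}=\varprojlim\{X_k,f^{k+1}_k\}$, with projection $f_0:X_{\rm Sch}\to X_0$. **The Schreier continuum.** Let $a$ and $b$ be loops in $X_0$ based at $x_0$ with $a\cap b=\{x_0\}$, such that $a\subset H_0$ crosses $C_0$ exactly once and $b\subset F_0$ crosses $D_0$ exactly once; concretely, $a\cup b$ is the image of $\{(x,y,z)\in Y: |x|=|z|,\ y\ge 0\}$. Put $\Lambda_0=a\cup b$, a figure eight. The (simplified) Schreier continuum is $\Lambda=f_0^{-1}(\Lambda_0)\subset X_{\rm Sch}$, the union of all lifts of $a$ and $b$; equivalently, $\Lambda$ is the inverse limit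 of the finite graphs $\Lambda_k\subset X_k$ that are the preimages of $\Lambda_0$. Its vertex set is the fibre $V(\Lambda)=f_0^{-1}(x_0)$, with the subspace topology. **Leaves and ends.** The leaf of a point of $X_{\rm Sch}$ (or of $\Lambda$) is its path component, with the leaf topology, that is, the topology generated by the path components of the open subsets of the ambient space. In this topology the leaves of $X_{\rm Sch}$ are surfaces and the leaves of $\Lambda$ are graphs. The number of ends of a leaf is the number of its Freudenthal ends. **Proposition.** 1. The set of vertices $v\in V(\Lambda)$ whose path component in $\Lambda$ has $2$ or $4$ ends is a meager subset of $V(\Lambda)$. 2. The generic leaf of $X_{\rm Sch}$ has $1$ end: the set of points $x\in X_{\rm Sch}$ whose leaf has exactly one end is residual in $X_{\rm Sch}$. -/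

import Mathlib

open Set TopologicalSpace

/-! # Leaves and ends -/

section LeavesAndEnds

variable (X : Type*) [TopologicalSpace X]

/-- The leaf topology on a space `X`: it is generated by the path components of the open sets
of `X`. In a chart `V × Z` with `V` locally path connected and `Z` totally disconnected, a path
component of an open set lies in a single plaque `V × {z}` and is open in it, so this is the
topology for which the plaques `V × {z}` (with the topology of `V`) are open. -/
abbrev leafTopology : TopologicalSpace X :=
  generateFrom {s | ∃ (U : Set X) (x : X), IsOpen U ∧ x ∈ U ∧ s = pathComponentIn U x}

/-- The leaf through `x`: the path component of `x` in `X`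
(equipped below with the leaf topology, not with the subspace topology). -/
def Leaf {X : Type*} [TopologicalSpace X] (x : X) : Type _ := {y : X // y ∈ pathComponent x}

instance {X : Type*} [TopologicalSpace X] (x : X) : TopologicalSpace (Leaf x) :=
  (leafTopology X).induced Subtype.val

/-- The (Freudenthal) ends of a space: consistent choices, for every compact `K`, of a connected
component of the complement of `K`. The chosen components are automatically unbounded, that is,
not contained in any compact set. -/
def Ends : Type _ :=
  {e : Compacts X → Set X //
    (∀ K : Compacts X, ∃ x ∈ (K : Set X)ᶜ, e K = connectedComponentIn (K : Set X)ᶜ x) ∧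
    ∀ K K' : Compacts X, (K : Set X) ⊆ K' → e K' ⊆ e K}

/-- The number of ends of the leaf through `x`. -/
noncomputable def numEnds {X : Type*} [TopologicalSpace X] (x : X) : ℕ∞ :=
  ENat.card (Ends (Leaf x))

end LeavesAndEnds

/-! # The Schori solenoid -/

namespace Schori

/-- The surface `Y` obtained by cutting a closed surface `X₀` of genus two along the two curves
`C₀`, `D₀`: the unit sphere with coordinates `(x, y, z)` minus four disjoint open round caps,
those where `|x| + |z| > 5 / 4`. Its boundary circles, the seams, are
`C'` (`x > 0`, `z > 0`), `C''` (`x < 0`, `z > 0`), `D'` (`x > 0`, `z < 0`) and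
`D''` (`x < 0`, `z < 0`). Gluing `C'` to `C''` and `D'` to `D''` by the reflection `x ↦ -x` gives
the genus two surface `X₀`, the union of the two one-holed tori `H₀` (the image of `0 ≤ z`) and
`F₀` (the image of `z ≤ 0`). -/
def CutSurface : Type :=
  {p : ℝ × ℝ × ℝ // p.1 ^ 2 + p.2.1 ^ 2 + p.2.2 ^ 2 = 1 ∧ |p.1| + |p.2.2| ≤ 5 / 4}

instance : TopologicalSpace CutSurface :=
  inferInstanceAs (TopologicalSpace
    {p : ℝ × ℝ × ℝ // p.1 ^ 2 + p.2.1 ^ 2 + p.2.2 ^ 2 = 1 ∧ |p.1| + |p.2.2| ≤ 5 / 4})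

namespace CutSurface

/-- First coordinate. -/
def x (p : CutSurface) : ℝ := p.1.1
/-- Second coordinate. -/
def y (p : CutSurface) : ℝ := p.1.2.1
/-- Third coordinate. -/
def z (p : CutSurface) : ℝ := p.1.2.2

/-- The reflection `(x, y, z) ↦ (-x, y, z)`; it exchanges `C'` with `C''` and `D'` with `D''`. -/
def mirror (p : CutSurface) : CutSurface :=
  ⟨(-p.1.1, p.1.2.1, p.1.2.2), by simpa using p.2⟩

/-- The boundary circle `C'`. -/
def onC (p : CutSurface) : Prop := 0 < p.x ∧ 0 < p.z ∧ p.x + p.z = 5 / 4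

/-- The boundary circle `D'`. -/
def onD (p : CutSurface) : Prop := 0 < p.x ∧ p.z < 0 ∧ p.x - p.z = 5 / 4

/-- The point `(0, 1, 0)` of `Y`; it lies on the curve `z = 0` that separates the handles. -/
def base : CutSurface := ⟨(0, 1, 0), by norm_num⟩

end CutSurface

/-- The copies of `Y` from which `X_k` is assembled: one for `X₀`, and `X_{k+1}` is made from
three copies of `X_k` (cut open). The copies number 1, 2, 3 are indexed by `0, 1, 2 : Fin 3`. -/
def Sheet : ℕ → Type
  | 0 => Unit
  | k + 1 => Sheet k × Fin 3

instance (k : ℕ) : TopologicalSpace (Sheet k) := ⊥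

/-- The sheet of `X_k` that carries the base point `x_k ∈ H_k ∩ F_k`: always in copy number 2,
because `H_{k+1}` is made from the copies 2, 3 and `F_{k+1}` from the copies 1, 2. -/
def baseSheet : (k : ℕ) → Sheet k
  | 0 => ()
  | k + 1 => (baseSheet k, 1)

open Classical in
/-- In `X_k` the seam `C'` of the sheet `v` is glued to the seam `C''` of the sheet `crossC k v`.
The curve `C_k ⊂ H_k` along which `X_k` is cut is the seam that is the side `C''` of the base
sheet. To form `X_{k+1}`, the sides of the cut `C_k` in the copies 2 and 3 are glued crosswise,
those in copy 1 are glued back to each other; every other seam remains inside its copy. -/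
noncomputable def crossC : (k : ℕ) → Sheet k → Sheet k
  | 0, _ => ()
  | k + 1, (v, i) =>
      (crossC k v, if crossC k v = baseSheet k then Equiv.swap (1 : Fin 3) 2 i else i)

open Classical in
/-- In `X_k` the seam `D'` of the sheet `v` is glued to the seam `D''` of the sheet `crossD k v`.
The curve `D_k ⊂ F_k` is the seam that is the side `D''` of the base sheet. To form `X_{k+1}`,
the sides of the cut `D_k` in the copies 1 and 2 are glued crosswise, those in copy 3 are glued
back to each other; every other seam remains inside its copy. -/
noncomputable def crossD : (k : ℕ) → Sheet k → Sheet k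
  | 0, _ => ()
  | k + 1, (v, i) =>
      (crossD k v, if crossD k v = baseSheet k then Equiv.swap (0 : Fin 3) 1 i else i)

/-- The identifications of boundary points that produce the closed surface `X_k`. -/
inductive Seam (k : ℕ) : CutSurface × Sheet k → CutSurface × Sheet k → Prop
  | C (p : CutSurface) (v : Sheet k) (hp : p.onC) : Seam k (p, v) (p.mirror, crossC k v)
  | D (p : CutSurface) (v : Sheet k) (hp : p.onD) : Seam k (p, v) (p.mirror, crossD k v)

/-- The closed surface `X_k`, of genus `3 ^ k + 1`, as a quotient space. -/
def Surface (k : ℕ) : Type := Quot (Seam k)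

instance (k : ℕ) : TopologicalSpace (Surface k) :=
  inferInstanceAs (TopologicalSpace (Quot (Seam k)))

/-- The three-to-one covering `f : X_{k+1} → X_k` that forgets the number of the copy. -/
def bond (k : ℕ) : Surface (k + 1) → Surface k :=
  Quot.map (fun q : CutSurface × (Sheet k × Fin 3) => (q.1, q.2.1)) (by
    rintro _ _ (⟨p, v, hp⟩ | ⟨p, v, hp⟩)
    · exact Seam.C p v.1 hp
    · exact Seam.D p v.1 hp)

/-- The Schori solenoid, the inverse limit of the surfaces `X_k`. -/
def Solenoid : Type := {x : (k : ℕ) → Surface k // ∀ k, bond k (x (k + 1)) = x k}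

instance : TopologicalSpace Solenoid :=
  inferInstanceAs (TopologicalSpace {x : (k : ℕ) → Surface k // ∀ k, bond k (x (k + 1)) = x k})

/-- The projection of the solenoid to the genus two surface `X₀`. -/
def proj (x : Solenoid) : Surface 0 := x.1 0

/-! # The Schreier continuum -/

/-- The base point `x₀ ∈ H₀ ∩ F₀` of `X₀`. -/
def basePoint : Surface 0 := Quot.mk _ (CutSurface.base, ())

/-- The figure eight `Λ₀ ⊂ X₀`: the union of two loops `a` and `b` based at `x₀`. The points
of `Y` with `|x| = |z|` and `0 ≤ y` form four arcs that start at `(0, 1, 0)` and end on the four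
boundary circles. The loop `a` runs along one of them (`0 ≤ z`) to `C'`, crosses over to `C''`
and returns to `x₀` along another one; the loop `b` (`z ≤ 0`) does the same through
`D'` and `D''`. -/
def figureEight : Set (Surface 0) :=
  {q | ∃ p : CutSurface, |p.x| = |p.z| ∧ 0 ≤ p.y ∧ q = Quot.mk _ (p, ())}

/-- The (simplified) Schreier continuum `Λ` of the Schori solenoid: the union of all lifts of the
loops `a` and `b` to the solenoid. It is the inverse limit of the finite graphs `Λ_k ⊂ X_k` that
are the preimages of `Λ₀`. -/
def SchreierContinuum : Type := {x : Solenoid // proj x ∈ figureEight}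

instance : TopologicalSpace SchreierContinuum :=
  inferInstanceAs (TopologicalSpace {x : Solenoid // proj x ∈ figureEight})

/-- The set `V(Λ)` of vertices of the Schreier continuum: the fibre over `x₀`. -/
def vertices : Set SchreierContinuum := {v | proj v.1 = basePoint}

end Schori

/-!
The sheets of the solenoid are indexed by infinite words in the copy numbers `0, 1, 2`, and every
point of the solenoid is `pt p w` for a place `p` in `Y` and a word `w`. Crossing a seam of the
handle `H` or `F` acts on words as an odometer on the digits `1, 2` or `1, 0`, whose carry stops
at the third digit (`shift`). If `w` contains infinitely many digits `0` and `2`, only finitely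
many carries occur, so the orbit of `w` is the set of words with the same tail, and the leaf
through `pt p w` is the union of the plaques over these words.

The copy of `X_n` (cut open along `C_n` and `D_n`) that contains `w` consists of the words that
agree with `w` from the place `n` on. If `w n = 0`, then its sides `C_n'` and `C_n''` are glued to
each other, so it is attached to the rest of the leaf along its two sides `D_n'` and `D_n''` only,
while the two other copies of `X_n` in `X_{n+1}` are joined along seams `C_n`. If moreover
`w (n + 1) = 2`, every further copy of some `X_N` is joined to the complement of the given one by a
seam that avoids it, so that this complement is connected in the Schreier graph
(`linked_tail_diff_block`). Words in which the pattern `02` occurs infinitely often are generic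
(`good_mem_residual`), and for them the leaf is exhausted by compact sets with connected
complement: it has one end (`card_ends_eq_one`). This applies to the solenoid and to the
Schreier continuum alike (`IsModel.numEnds_eq_one`), and a vertex with one end does not have two
or four.

The leaf topology is accessible because the solenoid is covered by three kinds of charts, over
the interior of `Y` and over collars of the seams of each handle, on which the word is locally a
continuous function with values in the Cantor set, hence constant on path components
(`wordLabel_eq_of_mem_pathComponentIn`). Therefore leaf-compact sets meet finitely many plaques;
conversely plaques are leaf-compact, since `Y` and the four arms of the figure eight are compact
and locally path connected, being unions of two graphs over convex sets (`isPiece_of_graphs`).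
-/

open Topology

/-! ### Leaves and spaces with one end -/

/-- A continuous map from a locally path connected space remains continuous for the leaf
topology. -/
lemma continuous_leafTopology {Z X : Type*} [TopologicalSpace Z] [LocallyPathConnectedSpace Z]
    [TopologicalSpace X] {g : Z → X} (hg : Continuous g) :
    @Continuous Z X _ (leafTopology X) g := by
  refine continuous_generateFrom_iff.2 ?_
  rintro _ ⟨U, x, hU, -, rfl⟩
  refine isOpen_iff_mem_nhds.2 fun z hz => ?_
  have hz' : JoinedIn U x (g z) := hz
  have hzU : z ∈ g ⁻¹' U := hz'.target_mem
  refine Filter.mem_of_superset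
    (((hU.preimage hg).pathComponentIn z).mem_nhds (mem_pathComponentIn_self hzU)) ?_
  intro y hy
  have h1 : JoinedIn U (g z) (g y) :=
    (JoinedIn.map hy hg).mono (image_preimage_subset g U)
  exact hz'.trans h1

/-- A space with arbitrarily large compact sets whose complement is connected and nonempty has
exactly one end. -/
lemma card_ends_eq_one {X : Type*} [TopologicalSpace X]
    (H : ∀ K : Compacts X, ∃ K' : Compacts X, (K : Set X) ⊆ K' ∧ IsConnected (K' : Set X)ᶜ) :
    ENat.card (Ends X) = 1 := by
  choose f hf hc using H
  choose y hy using fun K => (hc K).nonempty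
  have hcomp : ∀ {K : Compacts X} {z : X}, z ∈ (f K : Set X)ᶜ →
      connectedComponentIn (K : Set X)ᶜ z = connectedComponentIn (K : Set X)ᶜ (y K) := by
    intro K z hz
    have := (hc K).isPreconnected.subset_connectedComponentIn (hy K)
      (compl_subset_compl.2 (hf K))
    exact (connectedComponentIn_eq (this hz)).symm
  have hyK : ∀ K : Compacts X, y K ∈ (K : Set X)ᶜ := fun K h => hy K (hf K h)
  rw [ENat.card_eq_one_iff_unique]
  refine ⟨⟨⟨⟨fun K => connectedComponentIn (K : Set X)ᶜ (y K), fun K => ⟨y K, hyK K, rfl⟩,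
    fun K L hKL => ?_⟩⟩, ?_⟩⟩
  · have hm := hy (f K ⊔ f L)
    have hsub := hf (f K ⊔ f L)
    set m := y (f K ⊔ f L)
    dsimp only
    rw [← hcomp (K := K) (z := m) fun h => hm (hsub (.inl h)),
      ← hcomp (K := L) (z := m) fun h => hm (hsub (.inr h))]
    exact connectedComponentIn_mono _ (compl_subset_compl.2 hKL)
  · rintro ⟨e, he, hmono⟩
    apply Subtype.ext
    funext K
    change e K = connectedComponentIn (K : Set X)ᶜ (y K)
    obtain ⟨z, hz, hez⟩ := he (f K)
    obtain ⟨x, hx, hex⟩ := he K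
    have hzK : z ∈ e K := hmono K (f K) (hf K) (hez ▸ mem_connectedComponentIn hz)
    rw [← hcomp hz, hex]
    exact connectedComponentIn_eq (hex ▸ hzK)

namespace Schori

open Filter Relation

/-! ### Sheets of the solenoid as infinite words -/

/-- The digit exchanged with `1` when crossing the seam of a handle; `true` stands for the
handles `H_k` (curves `C_k`), `false` for the handles `F_k` (curves `D_k`). -/
def turn (h : Bool) : Fin 3 := if h then 2 else 0

/-- `crossC` and `crossD` as one function, indexed by the handle. -/
noncomputable def cross (h : Bool) : (k : ℕ) → Sheet k → Sheet k :=
  if h then crossC else crossD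

open Classical in
lemma cross_succ (h : Bool) (k : ℕ) (v : Sheet k) (i : Fin 3) :
    cross h (k + 1) (v, i) =
      (cross h k v, if cross h k v = baseSheet k then Equiv.swap 1 (turn h) i else i) := by
  cases h
  · exact congrArg (fun e : Equiv.Perm (Fin 3) =>
      (crossD k v, if crossD k v = baseSheet k then e i else i)) (Equiv.swap_comm 0 1)
  · rfl

lemma sheet_ext {k : ℕ} {a b : Sheet (k + 1)} : a = b ↔ a.1 = b.1 ∧ a.2 = b.2 := Prod.ext_iff

lemma cross_injective (h : Bool) : ∀ k, Function.Injective (cross h k)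
  | 0 => fun _ _ _ => rfl
  | k + 1 => by
    rintro ⟨v, i⟩ ⟨v', i'⟩ e
    obtain ⟨e₁, e₂⟩ := sheet_ext.1 ((cross_succ h k v i).symm.trans
      (e.trans (cross_succ h k v' i')))
    obtain rfl := cross_injective h k e₁
    dsimp only at e₂
    split_ifs at e₂ with hb
    · rw [(Equiv.swap _ _).injective e₂]
    · rw [e₂]

/-- An infinite sequence of copy numbers; it selects a sheet in every surface `X_k`. -/
abbrev Word := ℕ → Fin 3

/-- The sheet of `X_k` selected by a word. -/
def trunc (w : Word) : (k : ℕ) → Sheet k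
  | 0 => ()
  | k + 1 => (trunc w k, w k)

lemma trunc_eq_iff {u w : Word} : ∀ {k : ℕ}, trunc u k = trunc w k ↔ ∀ j < k, u j = w j
  | 0 => ⟨fun _ _ hj => absurd hj (Nat.not_lt_zero _), fun _ => rfl⟩
  | k + 1 => by
    rw [sheet_ext, Nat.forall_lt_succ_right]
    exact and_congr_left fun _ => trunc_eq_iff

lemma trunc_eq_base_iff {u : Word} : ∀ {k : ℕ}, trunc u k = baseSheet k ↔ ∀ j < k, u j = 1
  | 0 => ⟨fun _ _ hj => absurd hj (Nat.not_lt_zero _), fun _ => rfl⟩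
  | k + 1 => by
    rw [sheet_ext, Nat.forall_lt_succ_right]
    exact and_congr_left fun _ => trunc_eq_base_iff

lemma eq_of_trunc_eq {u w : Word} (h : ∀ k, trunc u k = trunc w k) : u = w :=
  funext fun k => trunc_eq_iff.1 (h (k + 1)) k k.lt_succ_self

lemma exists_trunc_eq : ∀ {k : ℕ} (v : Sheet k) (r : Word),
    ∃ w : Word, trunc w k = v ∧ ∀ j, k ≤ j → w j = r j
  | 0, _, r => ⟨r, rfl, fun _ _ => rfl⟩
  | k + 1, (v, i), r => by
    obtain ⟨w, hw, hr⟩ := exists_trunc_eq v (Function.update r k i)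
    refine ⟨w, ?_, fun j hj => ?_⟩
    · exact sheet_ext.2 ⟨hw, (hr k le_rfl).trans (Function.update_self ..)⟩
    · rw [hr j (by omega), Function.update_of_ne (by omega)]

open Classical in
/-- The homeomorphism of the Cantor set of words induced by the maps `cross h k`: crossing the
seam of the handle `h` in the solenoid. It is an odometer on the digits `1` and `turn h` whose
carry stops at the third digit. -/
noncomputable def shift (h : Bool) (w : Word) : Word := fun k =>
  if cross h k (trunc w k) = baseSheet k then Equiv.swap 1 (turn h) (w k) else w k

lemma trunc_shift (h : Bool) (w : Word) : ∀ k, trunc (shift h w) k = cross h k (trunc w k)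
  | 0 => rfl
  | k + 1 => by
    rw [trunc, trunc, cross_succ, trunc_shift h w k]
    rfl

lemma shift_injective (h : Bool) : Function.Injective (shift h) := fun u w e =>
  eq_of_trunc_eq fun k => cross_injective h k <| by rw [← trunc_shift, ← trunc_shift, e]

open Classical in
lemma shift_apply (h : Bool) (w : Word) (m : ℕ) :
    shift h w m =
      if ∀ j < m, shift h w j = 1 then Equiv.swap 1 (turn h) (w m) else w m := by
  simp only [← trunc_eq_base_iff, trunc_shift]
  rfl

lemma turn_ne_one (h : Bool) : turn h ≠ 1 := by cases h <;> decide

lemma turn_not_ne (h : Bool) : turn (!h) ≠ turn h := by cases h <;> decide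

/-- The digit `turn (!h)` is left alone by `shift h`. -/
lemma shift_apply_eq_turn_not {h : Bool} {w : Word} {m : ℕ} :
    shift h w m = turn (!h) ↔ w m = turn (!h) := by
  rw [shift_apply]
  split_ifs with hm
  · rw [← Equiv.eq_symm_apply, Equiv.symm_swap,
      Equiv.swap_apply_of_ne_of_ne (turn_ne_one _) (turn_not_ne _)]
  · rfl

/-- The carry of `shift h` stops at the digit `turn (!h)`. -/
lemma shift_apply_eq_self {h : Bool} {w : Word} {n m : ℕ} (hn : w n = turn (!h)) (hm : n < m) :
    shift h w m = w m := by
  rw [shift_apply, if_neg]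
  intro H
  exact turn_ne_one (!h) ((shift_apply_eq_turn_not.2 hn).symm.trans (H n hm))

/-- The word `d ⋯ d i r_{n+1} r_{n+2} ⋯` that starts with `n` digits `d`. -/
def prefixed (n : ℕ) (d i : Fin 3) (r : Word) : Word := fun m =>
  if m < n then d else if m = n then i else r m

lemma shift_prefixed (h : Bool) (n : ℕ) (r : Word) :
    shift h (prefixed n (turn h) 1 r) = prefixed n 1 (turn h) r := by
  have key : ∀ m < n, shift h (prefixed n (turn h) 1 r) m = 1 := by
    intro m
    induction m using Nat.strong_induction_on with
    | _ m ih =>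
      intro hm
      rw [shift_apply, if_pos fun j hj => ih j hj (hj.trans hm)]
      simp [prefixed, hm]
  have keyn : shift h (prefixed n (turn h) 1 r) n = turn h := by
    rw [shift_apply, if_pos key]
    simp [prefixed]
  funext m
  rcases lt_trichotomy m n with hm | rfl | hm
  · rw [key m hm]; simp [prefixed, hm]
  · rw [keyn]; simp [prefixed]
  · rw [shift_apply, if_neg fun H => turn_ne_one h (keyn.symm.trans (H n hm))]
    simp [prefixed, hm.not_gt, hm.ne']

/-! ### The Schreier graph -/

/-- Two words in `S` are linked if they are joined by an edge of the Schreier graph, that is, if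
the corresponding sheets of the solenoid share a seam. -/
def Link (S : Set Word) (u w : Word) : Prop :=
  u ∈ S ∧ w ∈ S ∧ ∃ h, w = shift h u ∨ u = shift h w

lemma Link.symm {S : Set Word} {u w : Word} (h : Link S u w) : Link S w u :=
  ⟨h.2.1, h.1, h.2.2.imp fun _ => Or.symm⟩

lemma Link.mono {S S' : Set Word} (hS : S ⊆ S') {u w : Word} (h : Link S u w) : Link S' u w :=
  ⟨hS h.1, hS h.2.1, h.2.2⟩

/-- Connection by a path of the Schreier graph within `S`. -/
abbrev Linked (S : Set Word) : Word → Word → Prop := ReflTransGen (Link S)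

lemma Linked.symm {S : Set Word} {u w : Word} (h : Linked S u w) : Linked S w u :=
  have : Std.Symm (Link S) := ⟨fun _ _ => Link.symm⟩
  ReflTransGen.stdSymm.symm _ _ h

lemma Linked.mono {S S' : Set Word} (hS : S ⊆ S') {u w : Word} (h : Linked S u w) :
    Linked S' u w :=
  ReflTransGen.mono (fun _ _ => Link.mono hS) _ _ h

/-- The sheets of the copy of `X_n` (cut open along `C_n` and `D_n`) that contains `w`. -/
def block (n : ℕ) (w : Word) : Set Word := {u | ∀ m, n ≤ m → u m = w m}

lemma mem_block_self (n : ℕ) (w : Word) : w ∈ block n w := fun _ _ => rfl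

lemma block_mono {n m : ℕ} (h : n ≤ m) (w : Word) : block n w ⊆ block m w :=
  fun _ hu j hj => hu j (h.trans hj)

lemma block_congr {n : ℕ} {u w : Word} (h : u ∈ block n w) : block n u = block n w := by
  ext v
  exact forall₂_congr fun m hm => by rw [h m hm]

lemma block_finite (n : ℕ) (w : Word) : (block n w).Finite := by
  refine Set.Finite.of_injOn (f := fun u (i : Fin n) => u i) (t := univ)
    (fun _ _ => mem_univ _) ?_ finite_univ
  intro u hu v hv e
  funext m
  by_cases hm : m < n
  · exact congrFun e ⟨m, hm⟩
  · rw [hu m (by omega), hv m (by omega)]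

/-- An edge between two of the three copies of `X_n` in `X_{n+1}`. -/
lemma link_prefixed (S : Set Word) (h : Bool) (n : ℕ) (r : Word)
    (h₁ : prefixed n (turn h) 1 r ∈ S) (h₂ : prefixed n 1 (turn h) r ∈ S) :
    Linked S (prefixed n (turn h) 1 r) (prefixed n 1 (turn h) r) :=
  .single ⟨h₁, h₂, h, .inl (shift_prefixed h n r).symm⟩

lemma prefixed_mem_block {n : ℕ} {d : Fin 3} {u w : Word} (h : u ∈ block (n + 1) w) :
    prefixed n d (u n) w ∈ block n u := by
  intro m hm
  rcases hm.eq_or_lt with rfl | hm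
  · simp [prefixed]
  · simp [prefixed, hm.not_gt, hm.ne', h m hm]

lemma eq_one_or_turn (i : Fin 3) : i = 1 ∨ ∃ h, i = turn h := by
  fin_cases i
  · exact .inr ⟨false, rfl⟩
  · exact .inl rfl
  · exact .inr ⟨true, rfl⟩

/-- The surface `X_n` cut open along `C_n` and `D_n` is connected. -/
lemma linked_block (n : ℕ) : ∀ {u w : Word}, u ∈ block n w → Linked (block n w) u w := by
  induction n with
  | zero =>
    intro u w h
    rw [show u = w from funext fun m => h m m.zero_le]
  | succ n ih =>
    -- Every copy of `X_n` is connected to the middle one.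
    have key : ∀ {u w : Word}, u ∈ block (n + 1) w →
        Linked (block (n + 1) w) u (prefixed n 1 1 w) := by
      intro u w hu
      have hsub : ∀ {v}, v ∈ block (n + 1) w → block n v ⊆ block (n + 1) w := fun hv =>
        block_congr hv ▸ block_mono n.le_succ _
      have hp : ∀ d i, prefixed n d i w ∈ block (n + 1) w := fun d i m hm => by
        simp [prefixed, (Nat.lt_of_succ_le hm).not_gt, (Nat.lt_of_succ_le hm).ne']
      have hin : ∀ {v v'}, v ∈ block (n + 1) w → v' ∈ block n v →
          Linked (block (n + 1) w) v v' := fun hv hv' => ((ih hv').mono (hsub hv)).symm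
      obtain hi | ⟨h, hi⟩ := eq_one_or_turn (u n)
      · exact hin hu (hi ▸ prefixed_mem_block hu)
      · refine (hin hu (hi ▸ prefixed_mem_block hu)).trans
          ((link_prefixed _ h n w (hp _ _) (hp _ _)).symm.trans (hin (hp _ _) ?_))
        have := prefixed_mem_block (d := 1) (hp (turn h) 1)
        simpa [prefixed] using this
    intro u w hu
    exact (key hu).trans (key (mem_block_self _ w)).symm

/-! ### The orbit of a generic word -/

/-- The words with the same tail as `w`. -/
def tail (w : Word) : Set Word := {u | u =ᶠ[atTop] w}

lemma mem_tail_iff {u w : Word} : u ∈ tail w ↔ ∃ n, u ∈ block n w := by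
  simp [tail, block, EventuallyEq, eventually_atTop]

lemma block_subset_tail (n : ℕ) (w : Word) : block n w ⊆ tail w :=
  fun _ h => mem_tail_iff.2 ⟨n, h⟩

/-- Words with infinitely many occurrences of the pattern `02`. They are generic, and the
leaves through the corresponding sheets have one end. -/
def Good (w : Word) : Prop := ∃ᶠ n in atTop, w n = 0 ∧ w (n + 1) = 2

lemma Good.exists_eq_turn {w : Word} (hw : Good w) (h : Bool) : ∃ᶠ n in atTop, w n = turn h := by
  cases h
  · exact hw.mono fun n hn => hn.1
  · rw [Good, frequently_atTop] at hw
    rw [frequently_atTop]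
    intro N
    obtain ⟨n, hn, h⟩ := hw N
    exact ⟨n + 1, by omega, h.2⟩

/-- Two words are near each other if they are equal or neighbours in the Schreier graph. -/
def Near (u w : Word) : Prop := u = w ∨ ∃ h, w = shift h u ∨ u = shift h w

lemma Near.symm {u w : Word} (h : Near u w) : Near w u :=
  h.imp Eq.symm fun ⟨h, e⟩ => ⟨h, e.symm⟩

lemma finite_near (u : Word) : {w | Near u w}.Finite := by
  have : {w | Near u w} ⊆ {u} ∪ ⋃ h, ({shift h u} ∪ shift h ⁻¹' {u}) := by
    rintro w (rfl | ⟨h, e⟩)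
    · exact .inl rfl
    · exact .inr (mem_iUnion.2 ⟨h, e.imp id Eq.symm⟩)
  refine Finite.subset ((finite_singleton u).union (finite_iUnion fun h => ?_)) this
  exact (finite_singleton _).union ((finite_singleton u).preimage (shift_injective h).injOn)

lemma shift_mem_tail_iff {w u : Word} (hw : Good w) (h : Bool) :
    shift h u ∈ tail w ↔ u ∈ tail w := by
  have key : (∃ᶠ n in atTop, u n = turn (!h)) → shift h u =ᶠ[atTop] u := fun H => by
    obtain ⟨n, hn⟩ := H.exists
    filter_upwards [eventually_gt_atTop n] with m hm
    exact shift_apply_eq_self hn hm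
  have hfr := hw.exists_eq_turn (!h)
  constructor
  · intro hu
    have hu' : shift h u =ᶠ[atTop] w := hu
    have := key <| (hfr.and_eventually hu').mono fun n hn =>
      shift_apply_eq_turn_not.1 (hn.2.trans hn.1)
    exact this.symm.trans hu'
  · intro hu
    have hu' : u =ᶠ[atTop] w := hu
    exact (key <| (hfr.and_eventually hu').mono fun n hn => hn.2.trans hn.1).trans hu'

lemma Near.mem_tail_iff {w u v : Word} (hw : Good w) (h : Near u v) :
    u ∈ tail w ↔ v ∈ tail w := by
  obtain rfl | ⟨h, rfl | rfl⟩ := h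
  · rfl
  · exact (shift_mem_tail_iff hw h).symm
  · exact shift_mem_tail_iff hw h

/-- The complement of the copy of `X_n` around `w` is connected in the Schreier graph if `02`
occurs in `w` at the place `n`: within `X_{n+1}`, the copy numbered `0` is attached to the rest
through its seams `D_n` only. The larger copies attach to this complement because the seams
joining them run through sheets `d ⋯ d i` with a constant beginning, which do not lie in the
given copy of `X_n`. -/
lemma linked_tail_diff_block {w : Word} {n : ℕ} (h0 : w n = 0) (h2 : w (n + 1) = 2) {u v : Word}
    (hu : u ∈ tail w \ block n w) (hv : v ∈ tail w \ block n w) :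
    Linked (tail w \ block n w) u v := by
  set S := tail w \ block n w
  -- Moving inside a copy of `X_N` that avoids the given copy of `X_n`.
  have hin : ∀ {N : ℕ} {a b : Word}, n ≤ N → a ∈ block (N + 1) w → a N ≠ w N → b ∈ block N a →
      Linked S a b := by
    intro N a b hN ha hne hb
    refine (Linked.mono (S' := S) (fun c hc => ⟨?_, fun hc' => hne ?_⟩)
      (linked_block N hb)).symm
    · exact block_subset_tail (N + 1) w (block_congr ha ▸ block_mono N.le_succ a hc)
    · rw [← hc N le_rfl, hc' N hN]
  have hmem : ∀ {N : ℕ} {d i : Fin 3}, prefixed N d i w ∈ block (N + 1) w := by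
    intro N d i m hm
    simp [prefixed, (Nat.lt_of_succ_le hm).not_gt, (Nat.lt_of_succ_le hm).ne']
  have hfst : ∀ {N : ℕ} {d i : Fin 3}, prefixed N d i w N = i := by simp [prefixed]
  have hpS : ∀ {N : ℕ} {d i : Fin 3}, n ≤ N → i ≠ w N → prefixed N d i w ∈ S := by
    intro N d i hN hi
    exact ⟨block_subset_tail _ _ hmem, fun H => hi (hfst.symm.trans (H _ hN))⟩
  have key : ∀ N, n + 1 ≤ N → ∀ u, u ∈ block N w → u ∉ block n w →
      Linked S u (prefixed n 1 1 w) := by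
    intro N hN
    induction N, hN using Nat.le_induction with
    | base =>
      intro u hu hun
      have hune : u n ≠ w n := fun H => hun fun m hm => by
        rcases hm.eq_or_lt with rfl | hm
        exacts [H, hu m hm]
      obtain hi | ⟨h, hi⟩ := eq_one_or_turn (u n)
      · exact hin le_rfl hu hune (hi ▸ prefixed_mem_block hu)
      · have h10 : (1 : Fin 3) ≠ w n := by rw [h0]; decide
        refine (hin le_rfl hu hune (hi ▸ prefixed_mem_block (d := 1) hu)).trans
          ((link_prefixed S h n w (hpS le_rfl h10) (hpS le_rfl (hi ▸ hune))).symm.trans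
            (hin le_rfl hmem (by rwa [hfst]) ?_))
        have := prefixed_mem_block (d := 1) (hmem (N := n) (d := turn h) (i := 1))
        rwa [hfst] at this
    | succ N hN ih =>
      -- The end of the seam that lies in the copy of `X_N` around `w`. The beginning `0 ⋯ 0 2`,
      -- which `w` might have from the place `n` on, is excluded: `0` is exchanged with `1` only.
      have hp : ∀ {d i : Fin 3}, i = w N → (d = 0 → i = 1) →
          prefixed N d i w ∈ S ∧ Linked S (prefixed N d i w) (prefixed n 1 1 w) := by
        intro d i hi hd
        have hb : prefixed N d i w ∉ block n w := fun H => by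
          have e0 := H n le_rfl
          have e2 := H (n + 1) n.le_succ
          rcases hN.eq_or_lt with rfl | hlt
          · simp only [prefixed, n.lt_succ_self, if_true, h0] at e0
            have := (hd e0).symm.trans (hi.trans h2)
            exact absurd this (by decide)
          · simp only [prefixed, hlt, (Nat.lt_of_succ_le hN), if_true, h0, h2] at e0 e2
            exact absurd (e0.symm.trans e2) (by decide)
        have hbN : prefixed N d i w ∈ block N w := by
          intro m hm
          rcases hm.eq_or_lt with rfl | hm
          · rw [hfst, hi]
          · exact hmem m hm
        exact ⟨⟨block_subset_tail _ _ hbN, hb⟩, ih _ hbN hb⟩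
      -- A copy of `X_N` adjacent to the one around `w`.
      have hadj1 : ∀ h u, u ∈ block (N + 1) w → u N = 1 → w N = turn h →
          Linked S u (prefixed n 1 1 w) := by
        intro h u hu hu1 hwh
        have h1 : (1 : Fin 3) ≠ w N := by rw [hwh]; exact (turn_ne_one h).symm
        obtain ⟨hp1, hp2⟩ := hp hwh.symm (d := 1) (by simp)
        exact (hin (by omega) hu (hu1 ▸ h1) (hu1 ▸ prefixed_mem_block (d := turn h) hu)).trans
          ((link_prefixed S h N w (hpS (by omega) h1) hp1).trans hp2)
      have hadj2 : ∀ h u, u ∈ block (N + 1) w → u N = turn h → w N = 1 →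
          Linked S u (prefixed n 1 1 w) := by
        intro h u hu hu1 hwh
        have h1 : turn h ≠ w N := by rw [hwh]; exact turn_ne_one h
        obtain ⟨hp1, hp2⟩ := hp hwh.symm (d := turn h) (fun _ => rfl)
        exact (hin (by omega) hu (hu1 ▸ h1) (hu1 ▸ prefixed_mem_block (d := 1) hu)).trans
          ((link_prefixed S h N w hp1 (hpS (by omega) h1)).symm.trans hp2)
      intro u hu hun
      by_cases hne : u N = w N
      · refine ih u (fun m hm => ?_) hun
        rcases hm.eq_or_lt with rfl | hm
        exacts [hne, hu m hm]
      obtain hw1 | ⟨h, hwh⟩ := eq_one_or_turn (w N)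
      · obtain hu1 | ⟨h, hi⟩ := eq_one_or_turn (u N)
        · exact absurd (hu1.trans hw1.symm) hne
        · exact hadj2 h u hu hi hw1
      · obtain hu1 | ⟨h', hi⟩ := eq_one_or_turn (u N)
        · exact hadj1 h u hu hu1 hwh
        · have h1 : (1 : Fin 3) ≠ w N := by rw [hwh]; exact (turn_ne_one h).symm
          exact (hin (by omega) hu hne (hi ▸ prefixed_mem_block (d := 1) hu)).trans
            ((link_prefixed S h' N w (hpS (by omega) h1)
              (hpS (by omega) (hi ▸ hne))).symm.trans (hadj1 h _ hmem hfst hwh))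
  have key' : ∀ {u}, u ∈ S → Linked S u (prefixed n 1 1 w) := fun {u} hu => by
    obtain ⟨N, hN⟩ := mem_tail_iff.1 hu.1
    exact key (max N (n + 1)) (le_max_right _ _) u (block_mono (le_max_left _ _) w hN) hu.2
  exact (key' hu).trans (key' hv).symm

/-! ### Points and charts of the solenoid -/

namespace CutSurface

/-- The boundary circle `C'` or `D'`, according to the handle. -/
def onSeam (h : Bool) (p : CutSurface) : Prop := if h then p.onC else p.onD

/-- Not on a boundary circle. -/
def interior (p : CutSurface) : Prop := |p.x| + |p.z| < 5 / 4

/-- The half of the surface that belongs to the given handle. -/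
def side (h : Bool) (p : CutSurface) : Prop := if h then 0 < p.z else p.z < 0

/-- The regions over which the charts of the solenoid are defined: the interior (for `none`), and
collars of the two seams of each handle (for `some h`). -/
def region : Option Bool → CutSurface → Prop
  | none, p => p.interior
  | some h, p => p.side h ∧ p.x ≠ 0

lemma continuous_x : Continuous x := continuous_fst.comp continuous_subtype_val
lemma continuous_z : Continuous z :=
  continuous_snd.comp (continuous_snd.comp continuous_subtype_val)

lemma isOpen_interior : IsOpen {p : CutSurface | p.interior} :=
  isOpen_lt (continuous_x.abs.add continuous_z.abs) continuous_const

lemma isOpen_side (h : Bool) : IsOpen {p : CutSurface | p.side h} := by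
  cases h
  · exact isOpen_lt continuous_z continuous_const
  · exact isOpen_lt continuous_const continuous_z

lemma onSeam.pos {h : Bool} {p : CutSurface} (hp : p.onSeam h) : 0 < p.x := by
  cases h
  · exact hp.1
  · exact hp.1

lemma onSeam.region {h : Bool} {p : CutSurface} (hp : p.onSeam h) : p.region (some h) :=
  ⟨by cases h <;> exact hp.2.1, hp.pos.ne'⟩

lemma onSeam.not_interior {h : Bool} {p : CutSurface} (hp : p.onSeam h) : ¬ p.interior := by
  rw [interior, abs_of_pos hp.pos, not_lt]
  cases h
  · rw [abs_of_neg hp.2.1, ← sub_eq_add_neg]; exact hp.2.2.ge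
  · rw [abs_of_pos hp.2.1]; exact hp.2.2.ge

lemma side_mirror {h : Bool} {p : CutSurface} : p.mirror.side h ↔ p.side h := Iff.rfl

lemma interior_mirror {p : CutSurface} : p.mirror.interior ↔ p.interior := by
  change |-p.x| + |p.z| < 5 / 4 ↔ _
  rw [abs_neg]; rfl

lemma region_mirror {c : Option Bool} {p : CutSurface} : p.mirror.region c ↔ p.region c := by
  cases c with
  | none => exact interior_mirror
  | some h => exact and_congr side_mirror (not_congr (neg_eq_zero (a := p.x)))

lemma exists_region (p : CutSurface) : ∃ c, p.region c := by
  by_cases hp : p.interior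
  · exact ⟨none, hp⟩
  have h1 : p.x ^ 2 + p.y ^ 2 + p.z ^ 2 = 1 := p.2.1
  have h2 : 5 / 4 ≤ |p.x| + |p.z| := not_lt.1 hp
  have hx : p.x ≠ 0 := fun h => by
    rw [h, abs_zero, zero_add] at h2
    nlinarith [sq_abs p.z, sq_nonneg p.y]
  have hz : p.z ≠ 0 := fun h => by
    rw [h, abs_zero, add_zero] at h2
    nlinarith [sq_abs p.x, sq_nonneg p.y]
  rcases hz.lt_or_gt with hz | hz
  · exact ⟨some false, hz, hx⟩
  · exact ⟨some true, hz, hx⟩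

end CutSurface

lemma Seam.mk (h : Bool) {k : ℕ} {p : CutSurface} (v : Sheet k) (hp : p.onSeam h) :
    Seam k (p, v) (p.mirror, cross h k v) := by
  cases h
  · exact Seam.D p v hp
  · exact Seam.C p v hp

lemma Seam.exists_eq {k : ℕ} {a b : CutSurface × Sheet k} (h : Seam k a b) :
    ∃ h p v, CutSurface.onSeam h p ∧ a = (p, v) ∧ b = (p.mirror, cross h k v) := by
  rcases h with ⟨p, v, hp⟩ | ⟨p, v, hp⟩
  · exact ⟨true, p, v, hp, rfl, rfl⟩
  · exact ⟨false, p, v, hp, rfl, rfl⟩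

/-- The point of the solenoid at the place `p` of the sheet given by the word `w`. -/
def pt (p : CutSurface) (w : Word) : Solenoid :=
  ⟨fun k => Quot.mk _ (p, trunc w k), fun _ => rfl⟩

lemma pt_mirror {h : Bool} {p : CutSurface} (hp : p.onSeam h) (w : Word) :
    pt p.mirror (shift h w) = pt p w := by
  apply Subtype.ext
  funext k
  change Quot.mk _ (p.mirror, trunc (shift h w) k) = Quot.mk _ (p, trunc w k)
  rw [trunc_shift]
  exact (Quot.sound (Seam.mk h _ hp)).symm

/-- Lifting of an identification in `X_k` to `X_{k+1}`. -/
lemma exists_lift_digit {k : ℕ} {a b : CutSurface × Sheet k}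
    (h : Quot.mk (Seam k) a = Quot.mk (Seam k) b) (i : Fin 3) :
    ∃ j : Fin 3, Quot.mk (Seam (k + 1)) (a.1, ((a.2, i) : Sheet k × Fin 3)) =
      Quot.mk (Seam (k + 1)) (b.1, ((b.2, j) : Sheet k × Fin 3)) := by
  classical
  -- The identification acts on the digits by a permutation, so it can be inverted.
  suffices ∃ e : Equiv.Perm (Fin 3), ∀ i,
      Quot.mk (Seam (k + 1)) (a.1, ((a.2, i) : Sheet k × Fin 3)) =
        Quot.mk (Seam (k + 1)) (b.1, ((b.2, e i) : Sheet k × Fin 3)) from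
    this.elim fun e he => ⟨e i, he i⟩
  induction Quot.eqvGen_exact h with
  | rel a b hab =>
    obtain ⟨b, p, v, hp, rfl, rfl⟩ := hab.exists_eq
    refine ⟨if cross b k v = baseSheet k then Equiv.swap 1 (turn b) else 1, fun i => ?_⟩
    refine (Quot.sound (Seam.mk b _ hp)).trans (congrArg (fun s => Quot.mk _ (p.mirror, s)) ?_)
    refine (cross_succ b k v i).trans (sheet_ext.2 ⟨rfl, ?_⟩)
    dsimp only
    split_ifs <;> rfl
  | refl a => exact ⟨1, fun _ => rfl⟩
  | symm a b hab ih =>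
    obtain ⟨e, he⟩ := ih (Quot.eqvGen_sound hab)
    exact ⟨e.symm, fun i => by rw [he, Equiv.apply_symm_apply]⟩
  | trans a b c hab hbc ih ih' =>
    obtain ⟨e, he⟩ := ih (Quot.eqvGen_sound hab)
    obtain ⟨e', he'⟩ := ih' (Quot.eqvGen_sound hbc)
    exact ⟨e.trans e', fun i => by rw [he, he', Equiv.trans_apply]⟩

lemma exists_eq_pt_of_proj {x : Solenoid} {p : CutSurface} (hp : proj x = Quot.mk _ (p, ())) :
    ∃ w, x = pt p w := by
  have step : ∀ (k : ℕ) (v : Sheet k), x.1 k = Quot.mk _ (p, v) →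
      ∃ i : Fin 3, x.1 (k + 1) = Quot.mk _ (p, ((v, i) : Sheet k × Fin 3)) := by
    intro k v hv
    obtain ⟨⟨p', v', i'⟩, hq⟩ := Quot.exists_rep (x.1 (k + 1))
    have hb : Quot.mk (Seam k) (p', v') = Quot.mk (Seam k) (p, v) := by
      rw [← hv, ← x.2 k, ← hq]; rfl
    obtain ⟨j, hj⟩ := exists_lift_digit hb i'
    exact ⟨j, hq.symm.trans hj⟩
  choose! f hf using step
  let v : (k : ℕ) → Sheet k := fun k => Nat.rec () (fun k v => (v, f k v)) k
  have hv : ∀ k, x.1 k = Quot.mk _ (p, v k) := by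
    intro k
    induction k with
    | zero => exact hp
    | succ k ih => exact hf k _ ih
  have ht : ∀ k, trunc (fun k => f k (v k)) k = v k := by
    intro k
    induction k with
    | zero => rfl
    | succ k ih => exact sheet_ext.2 ⟨ih, rfl⟩
  refine ⟨fun k => f k (v k), Subtype.ext (funext fun k => ?_)⟩
  rw [hv k, ← ht k]
  rfl

lemma exists_eq_pt (x : Solenoid) : ∃ p w, x = pt p w := by
  obtain ⟨⟨p, u⟩, hq⟩ := Quot.exists_rep (proj x)
  exact ⟨p, exists_eq_pt_of_proj hq.symm⟩

open Classical in
/-- The label of a point of a chart domain of `X_k`: the sheet containing it or, near a seam, the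
sheet to which the side `C''` or `D''` of this seam belongs. -/
noncomputable def label (c : Option Bool) (k : ℕ) (q : CutSurface × Sheet k) : Sheet k :=
  match c with
  | none => q.2
  | some h => if 0 < q.1.x then cross h k q.2 else q.2

/-- The part of `X_k` over the region of a chart on which the label is `v`. -/
def chart (c : Option Bool) (k : ℕ) (v : Sheet k) : Set (Surface k) :=
  {q | Quot.lift (fun a : CutSurface × Sheet k => a.1.region c ∧ label c k a = v) (by
    intro a b hab
    obtain ⟨h, p, u, hp, rfl, rfl⟩ := hab.exists_eq
    simp only [CutSurface.region_mirror, eq_iff_iff]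
    refine and_congr_right fun hc => ?_
    have hneg : ¬ 0 < p.mirror.x := not_lt.2 (neg_nonpos.2 hp.pos.le)
    cases c with
    | none => exact absurd hc hp.not_interior
    | some h' =>
      have hh : h = h' := by
        have h1 := hp.region.1
        have h2 := hc.1
        cases h <;> cases h' <;> first | rfl | exact absurd h2 (lt_asymm h1)
      subst hh
      simp only [label, if_pos hp.pos, if_neg hneg]) q}

lemma mk_mem_chart {c : Option Bool} {k : ℕ} {v : Sheet k} {a : CutSurface × Sheet k} :
    Quot.mk (Seam k) a ∈ chart c k v ↔ a.1.region c ∧ label c k a = v := Iff.rfl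

instance (k : ℕ) : DiscreteTopology (Sheet k) := ⟨rfl⟩

lemma isOpen_chart (c : Option Bool) (k : ℕ) (v : Sheet k) : IsOpen (chart c k v) := by
  refine isQuotientMap_quot_mk.isOpen_preimage.1 ?_
  cases c with
  | none =>
    exact (CutSurface.isOpen_interior.preimage continuous_fst).inter
      ((isOpen_discrete {v}).preimage continuous_snd)
  | some h =>
    have : Quot.mk (Seam k) ⁻¹' chart (some h) k v =
        ({p | p.side h} ∩ {p | 0 < p.x}) ×ˢ (cross h k ⁻¹' {v}) ∪
          ({p | p.side h} ∩ {p | p.x < 0}) ×ˢ {v} := by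
      ext ⟨p, u⟩
      refine mk_mem_chart.trans ?_
      rcases lt_trichotomy p.x 0 with hx | hx | hx
      · simp [CutSurface.region, label, hx, hx.ne, hx.not_gt]
      · simp [CutSurface.region, hx]
      · simp [CutSurface.region, label, hx, hx.ne', hx.not_gt]
    rw [this]
    exact (((CutSurface.isOpen_side h).inter
      (isOpen_lt continuous_const CutSurface.continuous_x)).prod (isOpen_discrete _)).union
      (((CutSurface.isOpen_side h).inter
        (isOpen_lt CutSurface.continuous_x continuous_const)).prod (isOpen_discrete _))

lemma chart_disjoint {c : Option Bool} {k : ℕ} {v v' : Sheet k} {q : Surface k}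
    (h : q ∈ chart c k v) (h' : q ∈ chart c k v') : v = v' := by
  obtain ⟨a, rfl⟩ := Quot.exists_rep q
  exact (mk_mem_chart.1 h).2.symm.trans (mk_mem_chart.1 h').2

/-- The domain of a chart of the solenoid, an open set homeomorphic to the product of a surface
and the Cantor set of words. -/
def chartDomain (c : Option Bool) : Set Solenoid := {x | x.1 0 ∈ chart c 0 ()}

lemma continuous_coord (k : ℕ) : Continuous fun x : Solenoid => x.1 k :=
  (continuous_apply k).comp continuous_subtype_val

lemma isOpen_chartDomain (c : Option Bool) : IsOpen (chartDomain c) :=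
  (isOpen_chart c 0 ()).preimage (continuous_coord 0)

lemma pt_mem_chartDomain {c : Option Bool} {p : CutSurface} {w : Word} :
    pt p w ∈ chartDomain c ↔ p.region c :=
  mk_mem_chart.trans (and_iff_left rfl)

open Classical in
/-- The label of the point `pt p w` of a chart domain: the Cantor set coordinate of the chart. -/
noncomputable def wordLabel (c : Option Bool) (p : CutSurface) (w : Word) : Word :=
  match c with
  | none => w
  | some h => if 0 < p.x then shift h w else w

lemma trunc_wordLabel (c : Option Bool) (p : CutSurface) (w : Word) (k : ℕ) :
    trunc (wordLabel c p w) k = label c k (p, trunc w k) := by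
  cases c with
  | none => rfl
  | some h =>
    simp only [wordLabel, label]
    split_ifs
    · exact trunc_shift h w k
    · rfl

/-- Since the words form a totally disconnected space, the label is constant along paths within a
chart domain. -/
lemma wordLabel_eq_of_mem_pathComponentIn {c : Option Bool} {p p' : CutSurface} {w w' : Word}
    (h : pt p' w' ∈ pathComponentIn (chartDomain c) (pt p w)) :
    wordLabel c p w = wordLabel c p' w' := by
  refine eq_of_trunc_eq fun k => ?_
  rw [trunc_wordLabel, trunc_wordLabel]
  have hpre : IsPreconnected ((fun x : Solenoid => x.1 k) ''
      pathComponentIn (chartDomain c) (pt p w)) :=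
    ((isPathConnected_pathComponentIn (JoinedIn.source_mem h)).isConnected.isPreconnected).image _
      (continuous_coord k).continuousOn
  have hp : p.region c := pt_mem_chartDomain.1 (JoinedIn.source_mem h)
  have hdisj : Disjoint (chart c k (label c k (p, trunc w k)))
      (⋃ v ∈ {v | v ≠ label c k (p, trunc w k)}, chart c k v) := by
    rw [disjoint_left]
    intro q hq hq'
    obtain ⟨v, hv, hqv⟩ := mem_iUnion₂.1 hq'
    exact hv (chart_disjoint hqv hq)
  have hcover : (fun x : Solenoid => x.1 k) '' pathComponentIn (chartDomain c) (pt p w) ⊆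
      chart c k (label c k (p, trunc w k)) ∪
        ⋃ v ∈ {v | v ≠ label c k (p, trunc w k)}, chart c k v := by
    rintro _ ⟨x, hx, rfl⟩
    obtain ⟨r, u, rfl⟩ := exists_eq_pt x
    have hr : r.region c := pt_mem_chartDomain.1 (pathComponentIn_subset hx)
    by_cases hl : label c k (r, trunc u k) = label c k (p, trunc w k)
    · exact .inl (mk_mem_chart.2 ⟨hr, hl⟩)
    · exact .inr (mem_iUnion₂.2 ⟨_, hl, mk_mem_chart.2 ⟨hr, rfl⟩⟩)
  have hpw : (pt p w).1 k ∈ chart c k (label c k (p, trunc w k)) := mk_mem_chart.2 ⟨hp, rfl⟩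
  have h' : (pt p' w').1 k ∈ chart c k (label c k (p, trunc w k)) :=
    hpre.subset_left_of_subset_union (isOpen_chart _ _ _)
      (isOpen_biUnion fun _ _ => isOpen_chart _ _ _) hdisj hcover
      ⟨_, mem_image_of_mem _ (mem_pathComponentIn_self (JoinedIn.source_mem h)), hpw⟩
      (mem_image_of_mem _ h)
  exact (mk_mem_chart.1 h').2.symm

lemma near_of_wordLabel_eq {c : Option Bool} {p p' : CutSurface} {w w' : Word}
    (h : wordLabel c p w = wordLabel c p' w') : Near w w' := by
  cases c with
  | none => exact .inl h
  | some b =>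
    simp only [wordLabel] at h
    split_ifs at h
    · exact .inl (shift_injective b h)
    · exact .inr ⟨b, .inl h.symm⟩
    · exact .inr ⟨b, .inr h⟩
    · exact .inl h

lemma wordLabel_eq_of_pt_eq {c : Option Bool} {p p' : CutSurface} {w w' : Word}
    (hc : p.region c) (h : pt p w = pt p' w') : wordLabel c p w = wordLabel c p' w' :=
  wordLabel_eq_of_mem_pathComponentIn
    (h ▸ mem_pathComponentIn_self (pt_mem_chartDomain.2 hc))

lemma near_of_pt_eq {p p' : CutSurface} {w w' : Word} (h : pt p w = pt p' w') : Near w w' := by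
  obtain ⟨c, hc⟩ := p.exists_region
  exact near_of_wordLabel_eq (wordLabel_eq_of_pt_eq hc h)

lemma eq_of_pt_eq {p p' : CutSurface} {w w' : Word} (hp : p.interior) (h : pt p w = pt p' w') :
    w = w' :=
  wordLabel_eq_of_pt_eq (c := none) hp h

/-- A point on a seam lies in two sheets only. -/
lemma eq_or_eq_shift_of_pt_eq {h : Bool} {p p' : CutSurface} {w w' : Word} (hp : p.onSeam h)
    (e : pt p w = pt p' w') : w' = w ∨ w' = shift h w := by
  have := wordLabel_eq_of_pt_eq hp.region e
  simp only [wordLabel, if_pos hp.pos] at this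
  split_ifs at this
  · exact .inl (shift_injective h this).symm
  · exact .inr this.symm

/-! ### The leaves of a generic point -/

/-- The properties of a subset of the surface `Y` on which the structure of leaves depends: the
preimages of its image in `X_0` have leaves that are assembled from copies of it along the seams
in the same way as the leaves of the solenoid are assembled from copies of `Y`. -/
structure IsPiece (A : Set CutSurface) : Prop where
  isCompact : IsCompact A
  locallyPathConnected : LocallyPathConnectedSpace A
  isPathConnected : IsPathConnected A
  isPreconnected_interior : IsPreconnected (A ∩ {p | p.interior})
  subset_closure : A ⊆ closure (A ∩ {p | p.interior})
  exists_onSeam : ∀ h, ∃ p ∈ A, p.onSeam h ∧ p.mirror ∈ A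

variable {T : Type*} [TopologicalSpace T] {A : Set CutSurface} {φ : T → Solenoid}

/-- The space `T` is embedded by `φ` in the solenoid as the preimage of the image of `A` in
`X_0`. -/
structure IsModel (A : Set CutSurface) (φ : T → Solenoid) : Prop where
  isEmbedding : IsEmbedding φ
  exists_pt : ∀ t, ∃ p ∈ A, ∃ w, φ t = pt p w
  exists_lift : ∀ p ∈ A, ∀ w, ∃ t, φ t = pt p w

lemma continuous_pt_left (w : Word) : Continuous fun p => pt p w :=
  Continuous.subtype_mk (continuous_pi fun k =>
    continuous_quot_mk.comp (Continuous.prodMk_left (trunc w k))) _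

namespace IsModel

/-- The inclusion of the copy of `A` in the sheet given by a word. -/
noncomputable def plaque (hφ : IsModel A φ) (w : Word) (p : A) : T :=
  (hφ.exists_lift p p.2 w).choose

lemma map_plaque (hφ : IsModel A φ) (w : Word) (p : A) : φ (hφ.plaque w p) = pt p w :=
  (hφ.exists_lift p p.2 w).choose_spec

lemma continuous_plaque (hφ : IsModel A φ) (w : Word) : Continuous (hφ.plaque w) := by
  refine hφ.isEmbedding.continuous_iff.2 ?_
  rw [show φ ∘ hφ.plaque w = fun p : A => pt p w from funext (hφ.map_plaque w)]
  exact (continuous_pt_left w).comp continuous_subtype_val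

/-- Every point has a neighbourhood in the leaf topology that meets only the sheets near to the
sheets of this point. -/
lemma exists_isOpen_near (hφ : IsModel A φ) (t : T) : ∃ N, IsOpen[leafTopology T] N ∧ t ∈ N ∧
    ∀ t' ∈ N, ∀ p w p' w', φ t = pt p w → φ t' = pt p' w' → Near w w' := by
  obtain ⟨q, -, u, ht⟩ := hφ.exists_pt t
  obtain ⟨c, hc⟩ := q.exists_region
  have hmem : t ∈ φ ⁻¹' chartDomain c := by
    rw [mem_preimage, ht]; exact pt_mem_chartDomain.2 hc
  refine ⟨pathComponentIn (φ ⁻¹' chartDomain c) t, isOpen_generateFrom_of_mem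
    ⟨_, t, (isOpen_chartDomain c).preimage hφ.isEmbedding.continuous, hmem, rfl⟩,
    mem_pathComponentIn_self hmem, fun t' ht' p w p' w' e e' => ?_⟩
  have hJ : JoinedIn (chartDomain c) (φ t) (φ t') :=
    (JoinedIn.map ht' hφ.isEmbedding.continuous).mono (image_preimage_subset _ _)
  exact near_of_wordLabel_eq (wordLabel_eq_of_mem_pathComponentIn (e ▸ e' ▸ hJ))

/-- The leaf of a point in a sheet with a generic word consists of the sheets with the same
tail. -/
lemma mem_pathComponent_iff (hA : IsPiece A) (hφ : IsModel A φ) {x t : T} {q : CutSurface}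
    {w : Word} (hw : Good w) (hx : φ x = pt q w) :
    t ∈ pathComponent x ↔ ∃ u ∈ tail w, ∃ p : A, φ t = pt p u := by
  constructor
  · rintro ⟨γ⟩
    -- The condition is locally constant along a path, for the leaf topology and hence for the
    -- topology of the interval.
    have : LocallyPathConnectedSpace unitInterval :=
      (convex_Icc (0 : ℝ) 1).locallyPathConnectedSpace
    have hγ := continuous_leafTopology γ.continuous
    have key : IsLocallyConstant fun s => ∃ u ∈ tail w, ∃ p : CutSurface, φ (γ s) = pt p u := by
      rw [IsLocallyConstant.iff_exists_open]
      intro s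
      obtain ⟨N, hN, hsN, hnear⟩ := hφ.exists_isOpen_near (γ s)
      refine ⟨γ ⁻¹' N, @IsOpen.preimage _ _ _ (leafTopology T) _ hγ _ hN, hsN, fun s' hs' => ?_⟩
      obtain ⟨p, -, u, e⟩ := hφ.exists_pt (γ s)
      obtain ⟨p', -, u', e'⟩ := hφ.exists_pt (γ s')
      refine propext ⟨?_, ?_⟩
      · rintro ⟨v', hv', r', er'⟩
        exact ⟨u, ((hnear _ hs' _ _ _ _ e er').mem_tail_iff hw).2 hv', p, e⟩
      · rintro ⟨v, hv, r, er⟩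
        exact ⟨u', ((hnear _ hs' _ _ _ _ er e').mem_tail_iff hw).1 hv, p', e'⟩
    have h01 := key.apply_eq_of_preconnectedSpace 0 1
    simp only [γ.source, γ.target] at h01
    obtain ⟨u, hu, p, e⟩ := h01.mp ⟨w, EventuallyEq.rfl, q, hx⟩
    obtain ⟨p', hp', u', e'⟩ := hφ.exists_pt t
    exact ⟨u', ((near_of_pt_eq (e.symm.trans e')).mem_tail_iff hw).1 hu, ⟨p', hp'⟩, e'⟩
  · rintro ⟨u, hu, p, ht⟩
    have hsame : ∀ v (p p' : A), Joined (hφ.plaque v p) (hφ.plaque v p') := by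
      intro v p p'
      have := isPathConnected_iff_pathConnectedSpace.1 hA.isPathConnected
      exact (PathConnectedSpace.joined p p').map (hφ.continuous_plaque v)
    have hstep : ∀ h v, ∃ p p' : A, hφ.plaque v p = hφ.plaque (shift h v) p' := by
      intro h v
      obtain ⟨r, hr, hrs, hr'⟩ := hA.exists_onSeam h
      refine ⟨⟨r, hr⟩, ⟨r.mirror, hr'⟩, hφ.isEmbedding.injective ?_⟩
      rw [hφ.map_plaque, hφ.map_plaque]
      exact (pt_mirror hrs v).symm
    have hlinked : ∀ {v v'}, Linked univ v v' →
        ∀ p p' : A, Joined (hφ.plaque v p) (hφ.plaque v' p') := by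
      intro v v' hv
      induction hv with
      | refl => exact hsame v
      | tail _ hlink ih =>
        intro p p'
        obtain ⟨-, -, h, rfl | rfl⟩ := hlink
        · obtain ⟨r, r', e⟩ := hstep h _
          exact (ih p r).trans (e ▸ hsame _ r' p')
        · obtain ⟨r, r', e⟩ := hstep h _
          exact (ih p r').trans (e ▸ hsame _ r p')
    obtain ⟨p₀, hp₀, w₀, hx₀⟩ := hφ.exists_pt x
    have hw₀ : w₀ ∈ tail w :=
      ((near_of_pt_eq (hx.symm.trans hx₀)).mem_tail_iff hw).1 EventuallyEq.rfl
    have e₁ : x = hφ.plaque w₀ ⟨p₀, hp₀⟩ := hφ.isEmbedding.injective (by rw [hφ.map_plaque, hx₀])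
    have e₂ : t = hφ.plaque u p := hφ.isEmbedding.injective (by rw [hφ.map_plaque, ht])
    have hl : ∀ {v}, v ∈ tail w → Linked univ v w := fun hv => by
      obtain ⟨n, hn⟩ := mem_tail_iff.1 hv
      exact (linked_block n hn).mono (subset_univ _)
    rw [e₁, e₂]
    exact hlinked ((hl hw₀).trans (hl hu).symm) _ _

/-- The leaf through a sheet with a generic word has one end: its compact sets are contained in
the lifts of copies of `X_n`, cut open, with connected complement. -/
theorem numEnds_eq_one (hA : IsPiece A) (hφ : IsModel A φ) {x : T} {q : CutSurface} {w : Word}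
    (hw : Good w) (hx : φ x = pt q w) : numEnds x = 1 := by
  have hleaf : ∀ {t : T}, t ∈ pathComponent x ↔ ∃ u ∈ tail w, ∃ p : A, φ t = pt p u :=
    mem_pathComponent_iff hA hφ hw hx
  have := hA.locallyPathConnected
  -- The plaques of the leaf.
  let Q : tail w → A → Leaf x := fun u p =>
    ⟨hφ.plaque u p, hleaf.2 ⟨u, u.2, p, hφ.map_plaque u p⟩⟩
  have hQ : ∀ u, Continuous (Q u) := fun u =>
    continuous_induced_rng.2 (continuous_leafTopology (hφ.continuous_plaque u))
  have hQφ : ∀ u p, φ (Q u p).1 = pt p u := fun u p => hφ.map_plaque u p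
  have hQeq : ∀ {y : Leaf x} {u : tail w} {p : A}, φ y.1 = pt p u → y = Q u p := fun h =>
    Subtype.ext (hφ.isEmbedding.injective (h.trans (hQφ _ _).symm))
  apply card_ends_eq_one
  intro K
  -- Compact sets meet finitely many plaques.
  have hK : ∀ᶠ n in atTop, ∀ y ∈ (K : Set (Leaf x)), ∃ u ∈ block n w, ∃ p : A, φ y.1 = pt p u := by
    refine K.isCompact.induction_on
      (p := fun s => ∀ᶠ n in atTop, ∀ y ∈ s, ∃ u ∈ block n w, ∃ p : A, φ y.1 = pt p u)
      (by simp) (fun s s' hs h => h.mono fun n hn y hy => hn y (hs hy)) ?_ ?_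
    · intro s s' hs hs'
      filter_upwards [hs, hs'] with n hn hn' y hy
      exact hy.elim (hn y) (hn' y)
    · intro y _
      obtain ⟨N, hN, hyN, hnear⟩ := hφ.exists_isOpen_near y.1
      obtain ⟨u, hu, p, e⟩ := hleaf.1 y.2
      refine ⟨Subtype.val ⁻¹' N, mem_nhdsWithin_of_mem_nhds (IsOpen.mem_nhds ⟨N, hN, rfl⟩ hyN), ?_⟩
      have hfin : ∀ᶠ n in atTop, ∀ v ∈ {v | Near u v}, v ∈ block n w := by
        refine (eventually_all_finite (finite_near u)).2 fun v hv => ?_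
        obtain ⟨n, hn⟩ := mem_tail_iff.1 (((show Near u v from hv).mem_tail_iff hw).1 hu)
        exact eventually_atTop.2 ⟨n, fun m hm => block_mono hm w hn⟩
      filter_upwards [hfin] with n hn y' hy'
      obtain ⟨v, hv, p', e'⟩ := hleaf.1 y'.2
      exact ⟨v, hn v (hnear _ hy' _ _ _ _ e e'), p', e'⟩
  obtain ⟨n, ⟨h0, h2⟩, hn⟩ := (hw.and_eventually hK).exists
  let B : Set (Leaf x) := {y | ∃ u ∈ block n w, ∃ p : A, φ y.1 = pt p u}
  have hB : IsCompact B := by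
    have : B = ⋃ u ∈ (Subtype.val ⁻¹' block n w : Set (tail w)), range (Q u) := by
      ext y
      simp only [mem_iUnion, mem_range]
      constructor
      · rintro ⟨u, hu, p, e⟩
        exact ⟨⟨u, block_subset_tail n w hu⟩, hu, p, (hQeq e).symm⟩
      · rintro ⟨u, hu, p, rfl⟩
        exact ⟨u, hu, p, hQφ u p⟩
    rw [this]
    have := isCompact_iff_compactSpace.1 hA.isCompact
    exact ((block_finite n w).preimage Subtype.val_injective.injOn).isCompact_biUnion
      fun u _ => isCompact_range (hQ u)
  refine ⟨⟨B, hB⟩, fun y hy => hn y hy, ?_⟩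
  -- The complement is the union of the connected sets `s u`.
  let s : tail w → Set (Leaf x) := fun u => range (Q u) \ B
  let S : Set (tail w) := {u | u.1 ∉ block n w}
  have hcompl : Bᶜ = ⋃ u ∈ S, s u := by
    ext y
    simp only [mem_iUnion]
    constructor
    · intro hy
      obtain ⟨u, hu, p, e⟩ := hleaf.1 y.2
      exact ⟨⟨u, hu⟩, fun hun => hy ⟨u, hun, p, e⟩, ⟨p, (hQeq e).symm⟩, hy⟩
    · rintro ⟨u, -, hy⟩
      exact hy.2
  have hint : ∀ u ∈ S, ∀ p : A, p.1.interior → Q u p ∈ s u := by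
    refine fun u hu p hp => ⟨mem_range_self p, ?_⟩
    rintro ⟨v, hv, p', e⟩
    rw [hQφ] at e
    exact hu (eq_of_pt_eq hp e ▸ hv)
  have hdense : Dense {p : A | p.1.interior} := by
    refine Subtype.dense_iff.2 (hA.subset_closure.trans (closure_mono ?_))
    exact fun p hp => ⟨⟨p, hp.1⟩, hp.2, rfl⟩
  have hconn : IsPreconnected {p : A | p.1.interior} := by
    refine IsInducing.subtypeVal.isPreconnected_image.1 ?_
    convert hA.isPreconnected_interior using 1
    ext p
    exact ⟨fun ⟨r, hr, e⟩ => e ▸ ⟨r.2, hr⟩, fun hp => ⟨⟨p, hp.1⟩, hp.2, rfl⟩⟩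
  have hs : ∀ u ∈ S, IsPreconnected (s u) := fun u hu =>
    (hconn.image _ (hQ u).continuousOn).subset_closure
      (by rintro _ ⟨p, hp, rfl⟩; exact hint u hu p hp)
      (sdiff_subset.trans ((hQ u).range_subset_closure_image_dense hdense))
  have hedge : ∀ h, ∀ u ∈ S, ∀ v ∈ S, v.1 = shift h u → (s u ∩ s v).Nonempty := by
    intro h u hu v hv e
    obtain ⟨r, hr, hrs, hr'⟩ := hA.exists_onSeam h
    have hnot : Q u ⟨r, hr⟩ ∉ B := by
      rintro ⟨u', hu', p', e'⟩
      rw [hQφ] at e'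
      obtain rfl | rfl := eq_or_eq_shift_of_pt_eq hrs e'
      · exact hu hu'
      · exact hv (e ▸ hu' : v.1 ∈ block n w)
    refine ⟨Q u ⟨r, hr⟩, ⟨mem_range_self _, hnot⟩, ⟨⟨⟨r.mirror, hr'⟩, ?_⟩, hnot⟩⟩
    refine (hQeq ?_).symm
    rw [hQφ, e]
    exact (pt_mirror hrs u).symm
  have hne : S.Nonempty := by
    have hmem : Function.update w n 1 ∈ tail w := mem_tail_iff.2 ⟨n + 1, fun m hm =>
      Function.update_of_ne (by omega) ..⟩
    refine ⟨⟨_, hmem⟩, fun H => ?_⟩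
    have := H n le_rfl
    simp [h0] at this
  refine ⟨?_, ?_⟩
  · obtain ⟨u, hu⟩ := hne
    obtain ⟨p, hp⟩ := hA.isPathConnected.nonempty
    have : Nonempty A := ⟨⟨p, hp⟩⟩
    obtain ⟨r, hr⟩ := hdense.nonempty
    exact ⟨Q u r, (hint u hu r hr).2⟩
  · change IsPreconnected Bᶜ
    rw [hcompl]
    refine IsPreconnected.biUnion_of_reflTransGen hs fun u hu v hv => ?_
    have hl := linked_tail_diff_block h0 h2 ⟨u.2, hu⟩ ⟨v.2, hv⟩
    have key : ∀ {a b : Word}, Linked (tail w \ block n w) a b → ∀ (ha : a ∈ tail w)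
        (hb : b ∈ tail w), ReflTransGen
          (fun i j : tail w => (s i ∩ s j).Nonempty ∧ i ∈ S) ⟨a, ha⟩ ⟨b, hb⟩ := by
      intro a b hab ha hb
      induction hab with
      | refl => exact .refl
      | @tail b c _ hbc ih =>
        refine (ih hbc.1.1).tail ⟨?_, hbc.1.2⟩
        obtain ⟨hb', hc', h, e | e⟩ := hbc
        · exact hedge h _ hb'.2 ⟨c, hb⟩ hc'.2 e
        · rw [inter_comm]
          exact hedge h ⟨c, hb⟩ hc'.2 ⟨b, hb'.1⟩ hb'.2 e
    exact key hl u.2 v.2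

end IsModel

/-! ### The surface and its figure eight as pieces -/

instance : T2Space CutSurface :=
  inferInstanceAs (T2Space
    {p : ℝ × ℝ × ℝ // p.1 ^ 2 + p.2.1 ^ 2 + p.2.2 ^ 2 = 1 ∧ |p.1| + |p.2.2| ≤ 5 / 4})

lemma convexOn_abs_add_abs : ConvexOn ℝ univ fun q : ℝ × ℝ => |q.1| + |q.2| :=
  ((convexOn_univ_norm (E := ℝ)).comp_linearMap (LinearMap.fst ℝ ℝ ℝ)).add
    ((convexOn_univ_norm (E := ℝ)).comp_linearMap (LinearMap.snd ℝ ℝ ℝ))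

/-- A union of two graphs of functions of `(x, z)` over convex sets containing the origin is a
piece if the graphs have an interior point in common and the union reaches the seams. -/
lemma isPiece_of_graphs {A : Set CutSurface} {Q : Bool → Set (ℝ × ℝ)}
    (hconv : ∀ i, Convex ℝ (Q i)) (hcomp : ∀ i, IsCompact (Q i)) (h0 : ∀ i, 0 ∈ Q i)
    {g : ∀ i, Q i → CutSurface} (hg : ∀ i, Continuous (g i))
    (hx : ∀ i q, (g i q).x = q.1.1) (hz : ∀ i q, (g i q).z = q.1.2)
    (hcommon : ∃ q₀ q₁, g false q₀ = g true q₁ ∧ (g false q₀).interior)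
    (hA : A = ⋃ i, range (g i)) (hseam : ∀ h, ∃ p ∈ A, p.onSeam h ∧ p.mirror ∈ A) :
    IsPiece A := by
  have hint : ∀ i q, (g i q).interior ↔ |q.1.1| + |q.1.2| < 5 / 4 := fun i q => by
    rw [CutSurface.interior, hx, hz]
  have hle : ∀ i (q : Q i), |q.1.1| + |q.1.2| ≤ 5 / 4 := fun i q => by
    rw [← hx, ← hz]; exact (g i q).2.2
  have hLPC : ∀ i, LocallyPathConnectedSpace (Q i) := fun i => (hconv i).locallyPathConnectedSpace
  have hCS : ∀ i, CompactSpace (Q i) := fun i => isCompact_iff_compactSpace.1 (hcomp i)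
  have hPC : ∀ i, IsPathConnected (range (g i)) := fun i => by
    have := isPathConnected_iff_pathConnectedSpace.1 ((hconv i).isPathConnected ⟨0, h0 i⟩)
    exact isPathConnected_range (hg i)
  obtain ⟨q₀, q₁, hq, hqint⟩ := hcommon
  have hunion : A = range (g true) ∪ range (g false) := by rw [hA, union_eq_iUnion]; congr!; grind
  have hAint : A ∩ {p | p.interior} =
      ⋃ i, g i '' {q | |q.1.1| + |q.1.2| < 5 / 4} := by
    rw [hA, iUnion_inter]
    congr! 2 with i
    ext p
    constructor
    · rintro ⟨⟨q, rfl⟩, hp⟩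
      exact ⟨q, (hint i q).1 hp, rfl⟩
    · rintro ⟨q, hp, rfl⟩
      exact ⟨⟨q, rfl⟩, (hint i q).2 hp⟩
  have hpre : ∀ i, IsPreconnected (g i '' {q | |q.1.1| + |q.1.2| < 5 / 4}) := by
    intro i
    refine IsPreconnected.image ?_ _ (hg i).continuousOn
    refine IsInducing.subtypeVal.isPreconnected_image.1 ?_
    have : Subtype.val '' {q : Q i | |q.1.1| + |q.1.2| < 5 / 4} =
        Q i ∩ {q ∈ univ | |q.1| + |q.2| < 5 / 4} := by
      ext q
      simp [and_comm]
    rw [this]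
    exact ((hconv i).inter (convexOn_abs_add_abs.convex_lt _)).isPreconnected
  refine ⟨?_, ?_, ?_, ?_, ?_, hseam⟩
  · rw [hA]
    exact isCompact_iUnion fun i => isCompact_range (hg i)
  · let G : (Σ i, Q i) → A := fun a => ⟨g a.1 a.2, hA ▸ mem_iUnion.2 ⟨a.1, a.2, rfl⟩⟩
    have hG : Continuous G := Continuous.subtype_mk (continuous_sigma hg) _
    have hGs : Function.Surjective G := by
      rintro ⟨p, hp⟩
      obtain ⟨i, q, rfl⟩ := mem_iUnion.1 (hA ▸ hp)
      exact ⟨⟨i, q⟩, rfl⟩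
    exact (hG.isClosedMap.isQuotientMap hG hGs).locallyPathConnectedSpace
  · rw [hunion]
    exact (hPC true).union (hPC false) ⟨_, ⟨q₁, rfl⟩, ⟨q₀, hq⟩⟩
  · rw [hAint]
    have : ∀ i, g true q₁ ∈ g i '' {q | |q.1.1| + |q.1.2| < 5 / 4} := by
      rintro (_ | _)
      · exact ⟨q₀, (hint _ _).1 hqint, hq⟩
      · exact ⟨q₁, (hint _ _).1 (hq ▸ hqint), rfl⟩
    exact isPreconnected_iUnion ⟨_, mem_iInter.2 this⟩ hpre
  · rw [hAint, hA]
    refine iUnion_subset fun i => ?_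
    refine Subset.trans ?_ (closure_mono (subset_iUnion _ i))
    refine (hg i).range_subset_closure_image_dense (Subtype.dense_iff.2 fun q hq => ?_)
    -- The segment from the origin to a point ends in the interior only at this point.
    have hseg : q ∈ closure (openSegment ℝ 0 q) := by
      rw [closure_openSegment]; exact right_mem_segment ℝ 0 q
    refine closure_mono ?_ hseg
    rintro _ ⟨a, b, ha, hb, hab, rfl⟩
    refine ⟨⟨_, hconv i (h0 i) hq ha.le hb.le hab⟩, ?_, rfl⟩
    have := hle i ⟨q, hq⟩
    simp only [smul_zero, zero_add, mem_ofPred_eq, Prod.smul_fst, Prod.smul_snd, smul_eq_mul,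
      abs_mul, abs_of_pos hb] at this ⊢
    nlinarith

/-- The projection of `Y` to the `(x, z)`-plane. It is convex, and `Y` is its double along the
four arcs of the unit circle in its boundary. -/
def shadow : Set (ℝ × ℝ) := {q | q.1 ^ 2 + q.2 ^ 2 ≤ 1 ∧ |q.1| + |q.2| ≤ 5 / 4}

lemma convex_shadow : Convex ℝ shadow := by
  have h : ConvexOn ℝ univ fun q : ℝ × ℝ => q.1 ^ 2 + q.2 ^ 2 :=
    ((even_two.convexOn_pow (𝕜 := ℝ)).comp_linearMap (LinearMap.fst ℝ ℝ ℝ)).add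
      ((even_two.convexOn_pow (𝕜 := ℝ)).comp_linearMap (LinearMap.snd ℝ ℝ ℝ))
  have e : shadow = {q ∈ univ | q.1 ^ 2 + q.2 ^ 2 ≤ 1} ∩ {q ∈ univ | |q.1| + |q.2| ≤ 5 / 4} := by
    ext q
    simp [shadow]
  rw [e]
  exact (h.convex_le 1).inter (convexOn_abs_add_abs.convex_le (5 / 4))

lemma isCompact_shadow : IsCompact shadow := by
  refine (isCompact_Icc (a := ((-1, -1) : ℝ × ℝ)) (b := (1, 1))).of_isClosed_subset ?_ ?_
  · exact (isClosed_le (f := fun q : ℝ × ℝ => q.1 ^ 2 + q.2 ^ 2) (by fun_prop)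
      continuous_const).inter (isClosed_le (f := fun q : ℝ × ℝ => |q.1| + |q.2|) (by fun_prop)
      continuous_const)
  · rintro ⟨a, b⟩ ⟨h, -⟩
    simp only at h
    refine ⟨⟨?_, ?_⟩, ⟨?_, ?_⟩⟩ <;> simp only <;> nlinarith

/-- The hemisphere `0 ≤ y` (for `true`) or `y ≤ 0` (for `false`) of `Y` as a graph. -/
noncomputable def hemisphere (e : Bool) (q : shadow) : CutSurface :=
  ⟨(q.1.1, (if e then 1 else -1) * √(1 - q.1.1 ^ 2 - q.1.2 ^ 2), q.1.2), by
    have h := Real.sq_sqrt (x := 1 - q.1.1 ^ 2 - q.1.2 ^ 2) (by linarith [q.2.1])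
    have he : (if e then 1 else -1 : ℝ) ^ 2 = 1 := by cases e <;> norm_num
    refine ⟨?_, q.2.2⟩
    dsimp only
    rw [mul_pow, h, he]
    ring⟩

lemma continuous_hemisphere (e : Bool) : Continuous (hemisphere e) :=
  Continuous.subtype_mk (by fun_prop) _

lemma mem_shadow (p : CutSurface) : (p.x, p.z) ∈ shadow := by
  have h : p.x ^ 2 + p.y ^ 2 + p.z ^ 2 = 1 := p.2.1
  exact ⟨by dsimp only; nlinarith [sq_nonneg p.y], p.2.2⟩

lemma eq_hemisphere {e : Bool} {p : CutSurface} (he : if e then 0 ≤ p.y else p.y ≤ 0) :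
    p = hemisphere e ⟨(p.x, p.z), mem_shadow p⟩ := by
  have h : p.x ^ 2 + p.y ^ 2 + p.z ^ 2 = 1 := p.2.1
  refine Subtype.ext (Prod.ext rfl (Prod.ext ?_ rfl))
  change p.y = _ * √(1 - p.x ^ 2 - p.z ^ 2)
  rw [show 1 - p.x ^ 2 - p.z ^ 2 = p.y ^ 2 by linarith, Real.sqrt_sq_eq_abs]
  cases e
  · simp only [Bool.false_eq_true, if_false] at he ⊢
    rw [abs_of_nonpos he]; ring
  · simp only [if_true] at he ⊢
    rw [abs_of_nonneg he]; ring

/-- The four arcs in `Y` whose image in `X_0` is the figure eight. -/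
def arms : Set CutSurface := {p | |p.x| = |p.z| ∧ 0 ≤ p.y}

lemma exists_arm_onSeam (h : Bool) : ∃ p ∈ arms, p.onSeam h ∧ p.mirror ∈ arms := by
  have hq : ((5 / 8, if h then 5 / 8 else -5 / 8) : ℝ × ℝ) ∈ shadow := by
    cases h <;> norm_num [shadow, abs_of_pos, abs_of_neg]
  have hy : (0 : ℝ) ≤ (if true then 1 else -1) *
      √(1 - (5 / 8) ^ 2 - (if h then 5 / 8 else -5 / 8 : ℝ) ^ 2) := by
    simp only [if_true, one_mul]; positivity
  have hxz : |(5 / 8 : ℝ)| = |(if h then 5 / 8 else -5 / 8 : ℝ)| := by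
    cases h <;> norm_num [abs_of_pos, abs_of_neg]
  refine ⟨hemisphere true ⟨_, hq⟩, ⟨hxz, hy⟩, ?_, (abs_neg _).trans hxz, hy⟩
  cases h
  · refine ⟨?_, ?_, ?_⟩ <;> norm_num [hemisphere, CutSurface.x, CutSurface.z]
  · refine ⟨?_, ?_, ?_⟩ <;> norm_num [hemisphere, CutSurface.x, CutSurface.z]

lemma zero_mem_shadow : 0 ∈ shadow := by norm_num [shadow]

lemma isPiece_univ : IsPiece univ := by
  refine isPiece_of_graphs (Q := fun _ => shadow) (g := hemisphere) (fun _ => convex_shadow)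
    (fun _ => isCompact_shadow) (fun _ => zero_mem_shadow) continuous_hemisphere
    (fun _ _ => rfl) (fun _ _ => rfl) ?_ ?_ ?_
  · have hq : ((1, 0) : ℝ × ℝ) ∈ shadow := by norm_num [shadow]
    refine ⟨⟨_, hq⟩, ⟨_, hq⟩, ?_, ?_⟩
    · refine Subtype.ext (Prod.ext rfl (Prod.ext ?_ rfl))
      norm_num [hemisphere]
    · norm_num [hemisphere, CutSurface.interior, CutSurface.x, CutSurface.z]
  · refine (eq_univ_of_forall fun p => ?_).symm
    rcases le_total 0 p.y with h | h
    · exact mem_iUnion.2 ⟨true, _, (eq_hemisphere (e := true) h).symm⟩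
    · exact mem_iUnion.2 ⟨false, _, (eq_hemisphere (e := false) h).symm⟩
  · intro h
    obtain ⟨p, -, hp, -⟩ := exists_arm_onSeam h
    exact ⟨p, mem_univ _, hp, mem_univ _⟩

lemma isPiece_arms : IsPiece arms := by
  let L : Bool → Set (ℝ × ℝ) := fun i => {q | q.1 = (if i then 1 else -1) * q.2}
  have hL : ∀ i, Convex ℝ (L i) := by
    rintro i q hq r hr a b - - -
    simp only [L, mem_ofPred_eq] at hq hr
    simp only [L, mem_ofPred_eq, Prod.fst_add, Prod.snd_add, Prod.smul_fst, Prod.smul_snd,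
      smul_eq_mul, hq, hr]
    ring
  have hLc : ∀ i, IsClosed (L i) := fun i => isClosed_eq (by fun_prop) (by fun_prop)
  have h0 : ∀ i, 0 ∈ shadow ∩ L i := fun i => ⟨zero_mem_shadow, by simp [L]⟩
  refine isPiece_of_graphs (Q := fun i => shadow ∩ L i)
    (g := fun i q => hemisphere true ⟨q.1, q.2.1⟩) (fun i => convex_shadow.inter (hL i))
    (fun i => isCompact_shadow.inter_right (hLc i)) h0
    (fun i => (continuous_hemisphere true).comp (continuous_subtype_val.subtype_mk _))
    (fun _ _ => rfl) (fun _ _ => rfl) ?_ ?_ exists_arm_onSeam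
  · refine ⟨⟨0, h0 _⟩, ⟨0, h0 _⟩, rfl, ?_⟩
    norm_num [hemisphere, CutSurface.interior, CutSurface.x, CutSurface.z]
  · ext p
    simp only [mem_iUnion, mem_range]
    constructor
    · rintro ⟨hp, hy⟩
      have hmem : ∃ i, (p.x, p.z) ∈ L i := by
        rcases abs_eq_abs.1 hp with h | h
        · exact ⟨true, by simp [L, h]⟩
        · exact ⟨false, by simp [L, h]⟩
      obtain ⟨i, hi⟩ := hmem
      exact ⟨i, ⟨(p.x, p.z), mem_shadow p, hi⟩, (eq_hemisphere (e := true) hy).symm⟩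
    · rintro ⟨i, q, rfl⟩
      refine ⟨?_, ?_⟩
      · have : q.1.1 = (if i then 1 else -1) * q.1.2 := q.2.2
        change |q.1.1| = |q.1.2|
        rw [this]
        cases i <;> simp
      · change (0 : ℝ) ≤ (if true then 1 else -1) * √_
        simp only [if_true, one_mul]
        positivity

/-! ### Genericity -/

lemma continuous_trunc : ∀ k, Continuous fun w : Word => trunc w k
  | 0 => continuous_const
  | k + 1 => by
    let G : Sheet k × Fin 3 → Sheet (k + 1) := fun a => a
    have hG : Continuous G := continuous_of_discreteTopology
    exact hG.comp ((continuous_trunc k).prodMk (continuous_apply k))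

lemma continuous_pt : Continuous fun a : CutSurface × Word => pt a.1 a.2 :=
  Continuous.subtype_mk (continuous_pi fun k =>
    continuous_quot_mk.comp (continuous_fst.prodMk ((continuous_trunc k).comp continuous_snd))) _

/-- The points in sheets with generic words are residual in every subspace of the solenoid
that is parametrized by the product of the Cantor set of words and a space that maps to `Y` with
a dense part in the interior. -/
lemma good_mem_residual {P S : Type*} [TopologicalSpace P] [TopologicalSpace S]
    {ψ : S → Solenoid} (hψ : Continuous ψ) {f : P → CutSurface}
    (hf : Dense {a | (f a).interior}) {η : P × Word → S} (hη : Continuous η)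
    (hη' : Function.Surjective η) (hψη : ∀ a w, ψ (η (a, w)) = pt (f a) w) :
    {s | ∃ p w, Good w ∧ ψ s = pt p w} ∈ residual S := by
  -- The pattern occurs at the place `m` on `F m`, and at some place `m ≥ n` on `G n`.
  let F : ℕ → Set S := fun m => ⋃ w ∈ {w : Word | w m = 0 ∧ w (m + 1) = 2},
    {s | (ψ s).1 (m + 2) ∈ chart none (m + 2) (trunc w (m + 2))}
  let G : ℕ → Set S := fun n => ⋃ m ∈ Ici n, F m
  have hG : ∀ n, IsOpen (G n) := fun n => isOpen_biUnion fun m _ => isOpen_biUnion fun w _ =>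
    (isOpen_chart _ _ _).preimage ((continuous_coord _).comp hψ)
  have hGd : ∀ n, Dense (G n) := by
    intro n
    rw [dense_iff_inter_open]
    rintro N hN ⟨s, hs⟩
    obtain ⟨⟨a, w⟩, rfl⟩ := hη' s
    obtain ⟨U, V, hU, hV, ha, hw, hUV⟩ := isOpen_prod_iff.1 (hN.preimage hη) a w hs
    obtain ⟨a', ha', ha'i⟩ := hf.inter_open_nonempty U hU ⟨a, ha⟩
    obtain ⟨I, v, hv, hIv⟩ := isOpen_pi_iff.1 hV w hw
    let m := max n (I.sup id + 1)
    let w' : Word := fun j => if j = m then 0 else if j = m + 1 then 2 else w j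
    have hw' : w' ∈ V := hIv fun j hj => by
      have hjm : j < m := lt_of_lt_of_le (Nat.lt_succ_of_le (Finset.le_sup (f := id) hj))
        (le_max_right _ _)
      have : w' j = w j := by
        simp only [w', if_neg hjm.ne, if_neg (hjm.trans m.lt_succ_self).ne]
      rw [this]
      exact (hv j hj).2
    refine ⟨η (a', w'), hUV ⟨ha', hw'⟩, mem_iUnion₂.2 ⟨m, mem_Ici.2 (le_max_left _ _),
      mem_iUnion₂.2 ⟨w', ⟨by simp [w'], by simp [w']⟩, ?_⟩⟩⟩
    change (ψ (η (a', w'))).1 (m + 2) ∈ chart none (m + 2) (trunc w' (m + 2))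
    rw [hψη]
    exact mk_mem_chart.2 ⟨ha'i, rfl⟩
  refine mem_of_superset
    (countable_iInter_mem.2 fun n => residual_of_dense_open (hG n) (hGd n)) fun s hs => ?_
  obtain ⟨⟨a, w⟩, rfl⟩ := hη' s
  refine ⟨f a, w, frequently_atTop.2 fun n => ?_, hψη a w⟩
  obtain ⟨m, hm, hsm⟩ := mem_iUnion₂.1 (mem_iInter.1 hs n)
  obtain ⟨u, ⟨hu0, hu2⟩, hu⟩ := mem_iUnion₂.1 hsm
  have hu' : (ψ (η (a, w))).1 (m + 2) ∈ chart none (m + 2) (trunc u (m + 2)) := hu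
  rw [hψη] at hu'
  have ht : trunc w (m + 2) = trunc u (m + 2) := (mk_mem_chart.1 hu').2
  rw [trunc_eq_iff] at ht
  exact ⟨m, hm, (ht m (by omega)).trans hu0, (ht (m + 1) (by omega)).trans hu2⟩

lemma isModel_solenoid : IsModel univ (id : Solenoid → Solenoid) where
  isEmbedding := .id
  exists_pt x := by
    obtain ⟨p, w, h⟩ := exists_eq_pt x
    exact ⟨p, mem_univ p, w, h⟩
  exists_lift p _ w := ⟨pt p w, rfl⟩

lemma isModel_schreierContinuum :
    IsModel arms (fun x : SchreierContinuum => (x.1 : Solenoid)) where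
  isEmbedding := IsEmbedding.subtypeVal
  exists_pt := by
    rintro ⟨x, p, hp, hy, h⟩
    obtain ⟨w, hw⟩ := exists_eq_pt_of_proj h
    exact ⟨p, ⟨hp, hy⟩, w, hw⟩
  exists_lift p hp w := ⟨⟨pt p w, p, hp.1, hp.2, rfl⟩, rfl⟩

lemma base_mem_arms : CutSurface.base ∈ arms := by
  refine ⟨?_, ?_⟩ <;> norm_num [CutSurface.base, CutSurface.x, CutSurface.y, CutSurface.z]

lemma interior_base : CutSurface.base.interior := by
  norm_num [CutSurface.interior, CutSurface.base, CutSurface.x, CutSurface.z]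

/-- The vertex of the Schreier continuum in the sheet given by a word. -/
def vertex (w : Word) : vertices :=
  ⟨⟨pt CutSurface.base w, CutSurface.base, base_mem_arms.1, base_mem_arms.2, rfl⟩, rfl⟩

lemma continuous_vertex : Continuous vertex :=
  ((continuous_pt.comp (Continuous.prodMk_right CutSurface.base)).subtype_mk _).subtype_mk _

lemma vertex_surjective : Function.Surjective vertex := by
  rintro ⟨⟨x, hx⟩, h⟩
  obtain ⟨w, rfl⟩ := exists_eq_pt_of_proj (p := CutSurface.base) h
  exact ⟨w, rfl⟩

end Schori

open Schori in
theorem proposition3p2 :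
    IsMeagre {v : Schori.vertices |
      numEnds (v : Schori.SchreierContinuum) = 2 ∨ numEnds (v : Schori.SchreierContinuum) = 4} ∧
    {x : Schori.Solenoid | numEnds x = 1} ∈ residual Schori.Solenoid := by
  constructor
  · refine Filter.mem_of_superset (good_mem_residual (S := vertices) (P := Unit)
      (ψ := fun v => v.1.1) (continuous_subtype_val.comp continuous_subtype_val)
      (f := fun _ => CutSurface.base) (fun _ => subset_closure interior_base)
      (η := fun a => vertex a.2) (continuous_vertex.comp continuous_snd)
      (fun v => (vertex_surjective v).elim fun w h => ⟨((), w), h⟩) fun _ _ => rfl) ?_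
    rintro v ⟨p, w, hw, hv⟩ h
    have h1 := isModel_schreierContinuum.numEnds_eq_one isPiece_arms hw hv
    simp only [mem_ofPred_eq, h1] at h
    exact absurd h (by decide)
  · refine Filter.mem_of_superset (good_mem_residual (S := Solenoid) (P := CutSurface) (ψ := id)
      continuous_id (f := id) ?_ (η := fun a => pt a.1 a.2) continuous_pt
      (fun x => (exists_eq_pt x).elim fun p h => h.elim fun w h => ⟨(p, w), h.symm⟩)
      fun _ _ => rfl) ?_
    · have := isPiece_univ.subset_closure
      rw [univ_inter] at this
      exact fun p => this (mem_univ p)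
    · rintro x ⟨p, w, hw, hx⟩
      exact isModel_solenoid.numEnds_eq_one isPiece_univ hw hx
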